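/- Let $q$ be a prime power, let $e>1$ be an integer dividing $q-1$, and let $I\subseteq\{0,1,\dots,e-1\}$. Let $\gamma$ be a primitive element of $\mathbb F_{q^2}$ and let $\omega=\mathrm{Norm}_{\mathbb F_{q^2}/\mathbb F_q}(\gamma)$. Put $C_i^{(e,q^2)}=\gamma^i\langle\gamma^e\rangle\subseteq\mathbb F_{q^2}$, $C_i^{(e,q)}=\omega^i\langle\omega^e\rangle\subseteq\mathbb F_q$ and $E=\bigcup_{i\in I}C_i^{(e,q)}$. Assume that $\mathrm{Cay}\bigl(\mathbb F_{q^2},\bigcup_{i\in I}C_i^{(e,q^2)}\bigr)$ is a strongly regular graph of negative Latin square type, i.e. it is neither edgeless nor complete and is strongly regular with parameters $(N^2,\ r(N+1),\ -N+r^2+3r,\ r^2+r)$ for some integers $N,r$. Let $Q:V=\mathbb F_q^{n}\to\mathbb F_q$, $n=2m$, be a nonsingular quadratic form (that is, the only vector $w$ with $Q(w)=0$ and $Q(v+w)=Q(v)+Q(w)$ for all $v\in V$ is $w=0$), and assume that $Q(x)=0$ for some nonzero $x\in V$ (for $m\ge1$ this excludes only the elliptic form in $n=2$ variables). For $X\subseteq\mathbb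 F_q$ let $D_X=\{x\in V: Q(x)\in X\}$, and let $D_0=D_{\{0\}}$. Then the three graphs $\mathrm{Cay}(V,D_E)$, $\mathrm{Cay}(V,D_{\mathbb F_q^*\setminus E})$ and $\mathrm{Cay}(V,D_0\setminus\{0\})$ are strongly regular (and neither edgeless nor complete), and together they decompose the complete graph on $V$ into a $3$-class amorphic association scheme: their adjacency relations, together with the identity relation $R_0$, form a symmetric association scheme on $V$ with three (nonempty) classes, and every fusion of it, obtained by merging relations according to a partition of the index set $\{0,1,2,3\}$ in which $\{0\}$ is a part, is again an association scheme. -/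

import Mathlib

/-- The set `γ ^ i * ⟨γ ^ e⟩`, a subset of the field `F`.  When `γ` generates `Fˣ` and `e` divides
`|Fˣ|`, these are, for `0 ≤ i < e`, the cyclotomic classes of order `e` of `F`. -/
def cyclotomicClass {F : Type*} [Field F] (γ : Fˣ) (e i : ℕ) : Set F :=
  {x | ∃ u ∈ Subgroup.zpowers (γ ^ e), x = ((γ ^ i * u : Fˣ) : F)}

/-- The set `D_X` of all vectors `x` with `Q x ∈ X`. -/
def levelSet {K V : Type*} [Field K] [AddCommGroup V] [Module K V] (Q : QuadraticForm K V)
    (X : Set K) : Set V :=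
  {x | Q x ∈ X}

open Classical in
/-- `G` is strongly regular with parameters `(v, k, l, μ)`; as usual, edgeless and complete graphs
are not counted as strongly regular. -/
def IsStronglyRegularWith {X : Type*} [Fintype X] (G : SimpleGraph X) (v k l μ : ℕ) : Prop :=
  G ≠ ⊥ ∧ G ≠ ⊤ ∧ G.IsSRGWith v k l μ

/-- `G` is strongly regular, for some parameters. -/
def IsStronglyRegular {X : Type*} [Fintype X] (G : SimpleGraph X) : Prop :=
  ∃ v k l μ : ℕ, IsStronglyRegularWith G v k l μ

/-- `G` is a strongly regular graph of negative Latin square type: its parameters are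
`(n ^ 2, r (n + 1), - n + r ^ 2 + 3 r, r ^ 2 + r)` for some `n` and `r`. -/
def IsNegativeLatinSquareType {X : Type*} [Fintype X] (G : SimpleGraph X) : Prop :=
  ∃ n r l : ℕ, (l : ℤ) = -(n : ℤ) + (r : ℤ) ^ 2 + 3 * (r : ℤ) ∧
    IsStronglyRegularWith G (n ^ 2) (r * (n + 1)) l (r ^ 2 + r)

/-- The relations `R 0, …, R d` form a symmetric association scheme with `d` classes on `X`. -/
structure IsAssociationScheme {X : Type*} {d : ℕ} (R : Fin (d + 1) → X → X → Prop) : Prop where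
  nonempty : ∀ i, ∃ x y, R i x y
  partition : ∀ x y, ∃! i, R i x y
  diagonal : ∀ x y, R 0 x y ↔ x = y
  symmetric : ∀ i x y, R i x y → R i y x
  intersection : ∀ i j k, ∃ p : ℕ, ∀ x y, R k x y → {z | R i x z ∧ R j z y}.ncard = p

/-- The fusion of the relations `R` along `f`: the `j`-th fused relation is the union of the `R i`
with `f i = j`. -/
def fusion {X : Type*} {d d' : ℕ} (R : Fin (d + 1) → X → X → Prop)
    (f : Fin (d + 1) → Fin (d' + 1)) : Fin (d' + 1) → X → X → Prop :=
  fun j x y => ∃ i, f i = j ∧ R i x y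

/-- An association scheme is amorphic if each of its fusions is an association scheme.  The fusions
correspond to the partitions of the index set in which `{0}` is a part; a partition into `d' + 1`
parts is given as the fibres of a surjection `f` onto `Fin (d' + 1)`. -/
def IsAmorphicAssociationScheme {X : Type*} {d : ℕ} (R : Fin (d + 1) → X → X → Prop) : Prop :=
  IsAssociationScheme R ∧
    ∀ (d' : ℕ) (f : Fin (d + 1) → Fin (d' + 1)), Function.Surjective f →
      (∀ i, f i = 0 ↔ i = 0) → IsAssociationScheme (fusion R f)

/-- The equality relation followed by the adjacency relations of the graphs `G 0, …, G (d - 1)`. -/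
def graphRelations {X : Type*} {d : ℕ} (G : Fin d → SimpleGraph X) :
    Fin (d + 1) → X → X → Prop :=
  Fin.cons (fun x y => x = y) (fun i => (G i).Adj)

/-! Write `q = |K|`. For a primitive additive character `ψ` of `K` and an even-dimensional
nonsingular `Q`, the Gauss sum `G = ∑ x, ψ (t * Q x)` does not depend on `t ≠ 0`. Completing the
square shows that the Fourier coefficient of `D_X` at the nontrivial character `x ↦ ψ (B (b, x))` is
`(G / q) * kloostermanSum ψ X (Q b)`. The form enters only through the factor `G / q` and the
argument `Q b`, so information about `X` can be carried from one form to another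
(`card_mul_charSum_levelSet`).

The source is the norm form of `L / K`, for which `G = -q`. The union of cyclotomic classes in `L`
is its level set over `E`, and the negative Latin square parameters say exactly that the Kloosterman
sums of `E` take only the values `-|E|` and `q - |E|` (`kloostermanSum_eq_or_eq`).

The target is `Q`. The sums of `E`, of its complement in `K \ {0}` and of `{0}` add up to zero, and
the last is `q - 1` at `0` and `-1` elsewhere. Hence at each nontrivial character exactly one of the
three sets has its Fourier coefficient raised by `G` above a base value
(`exists_isAmorphicPartition`). This pattern survives merging of sets, and it makes every
convolution of two indicators a combination of indicators, which gives all intersection numbers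
(`IsAmorphicPartition.ncard_eq`). -/

/-! ### Fourier analysis on a finite abelian group. -/

open scoped Classical in
/-- A function on a finite abelian group whose nontrivial Fourier coefficients vanish is constant. -/
theorem eq_of_forall_sum_mul_addChar_eq_zero {V : Type*} [AddCommGroup V] [Fintype V] (f : V → ℂ)
    (h : ∀ χ : AddChar V ℂ, χ ≠ 0 → ∑ x, f x * χ x = 0) (x y : V) : f x = f y := by
  have key : ∀ y, (Fintype.card V : ℂ) * f y = ∑ x, f x := by
    intro y
    calc (Fintype.card V : ℂ) * f y
        = ∑ x, f x * ∑ χ : AddChar V ℂ, χ (x - y) := by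
          simp only [AddChar.sum_apply_eq_ite, sub_eq_zero, mul_ite, mul_zero,
            Finset.sum_ite_eq', Finset.mem_univ, if_true]
          exact mul_comm _ _
      _ = ∑ χ : AddChar V ℂ, χ (-y) * ∑ x, f x * χ x := by
          simp only [Finset.mul_sum]
          rw [Finset.sum_comm]
          refine Finset.sum_congr rfl fun χ _ => Finset.sum_congr rfl fun x _ => ?_
          rw [sub_eq_add_neg, AddChar.map_add_eq_mul]
          ring
      _ = ∑ x, f x := by
          rw [Finset.sum_eq_single (0 : AddChar V ℂ)]
          · simp
          · intro χ _ hχ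
            rw [h χ hχ, mul_zero]
          · simp
  have hc : (Fintype.card V : ℂ) ≠ 0 := by simp
  exact mul_left_cancel₀ hc ((key x).trans (key y).symm)

/-- The Fourier transform of the indicator function of a set. -/
noncomputable def charSum {V : Type*} [AddCommGroup V] [Fintype V] (A : Set V)
    (χ : AddChar V ℂ) : ℂ :=
  ∑ x, A.indicator 1 x * χ x

theorem charSum_zero {V : Type*} [AddCommGroup V] [Fintype V] (A : Set V) :
    charSum A 0 = A.ncard := by
  classical
  simp [charSum, Set.indicator_apply, Set.ncard_eq_toFinset_card', Finset.sum_boole]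

theorem ncard_setOf_mem_sub_mem {V : Type*} [AddCommGroup V] [Fintype V] (A B : Set V) (z : V) :
    (({x | x ∈ A ∧ z - x ∈ B}.ncard : ℕ) : ℂ) =
      ∑ x, A.indicator 1 x * B.indicator 1 (z - x) := by
  classical
  rw [Set.ncard_eq_toFinset_card']
  simp only [Set.indicator_apply, Pi.one_apply, ← ite_and, mul_ite, mul_one, mul_zero]
  rw [Finset.sum_boole]
  congr 2
  ext x
  simp [and_comm]

/-- The Fourier transform turns convolution into multiplication. -/
theorem sum_ncard_mul_addChar {V : Type*} [AddCommGroup V] [Fintype V] (A B : Set V)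
    (χ : AddChar V ℂ) :
    ∑ z, (({x | x ∈ A ∧ z - x ∈ B}.ncard : ℕ) : ℂ) * χ z = charSum A χ * charSum B χ := by
  simp only [ncard_setOf_mem_sub_mem, Finset.sum_mul]
  rw [Finset.sum_comm, charSum, Finset.sum_mul]
  refine Finset.sum_congr rfl fun x _ => ?_
  rw [charSum, Finset.mul_sum, ← Equiv.sum_comp (Equiv.addRight x)]
  refine Finset.sum_congr rfl fun y _ => ?_
  simp only [Equiv.coe_addRight, add_sub_cancel_right, AddChar.map_add_eq_mul]
  ring

/-! ### Amorphic partitions, their intersection numbers and fusions. -/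

/-- The sets `A i` form a partition of `V` into symmetric sets, and the nontrivial characters are
partitioned by `κ` in such a way that the Fourier transform of `A i` takes one value on the
`i`-th part of the dual partition, and another, smaller by `N`, on all other parts. -/
structure IsAmorphicPartition {V : Type*} [AddCommGroup V] [Fintype V] {d : ℕ}
    (A : Fin (d + 1) → Set V) (κ : AddChar V ℂ → Fin (d + 1)) (c : Fin (d + 1) → ℂ) (N : ℂ) :
    Prop where
  zero : A 0 = {0}
  nonempty : ∀ i, (A i).Nonempty
  existsUnique : ∀ x, ∃! i, x ∈ A i
  neg_mem : ∀ i x, x ∈ A i → -x ∈ A i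
  charSum_eq : ∀ χ, χ ≠ 0 → ∀ i, charSum (A i) χ = c i + if κ χ = i then N else 0

namespace IsAmorphicPartition

variable {V : Type*} [AddCommGroup V] [Fintype V] {d : ℕ} {A : Fin (d + 1) → Set V}
  {κ : AddChar V ℂ → Fin (d + 1)} {c : Fin (d + 1) → ℂ} {N : ℂ}

theorem eq_of_mem (h : IsAmorphicPartition A κ c N) {i j : Fin (d + 1)} {x : V} (hi : x ∈ A i)
    (hj : x ∈ A j) : i = j :=
  (h.existsUnique x).unique hi hj

theorem zero_notMem (h : IsAmorphicPartition A κ c N) {i : Fin (d + 1)} (hi : i ≠ 0) :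
    (0 : V) ∉ A i :=
  fun h0 => hi (h.eq_of_mem h0 (by simp [h.zero]))

/-- With `δ i` the indicator of `κ χ = i`, the relations `δ i * δ j = 0` for `i ≠ j` and `δ i ^ 2 =
δ i` make the product of the transforms `c i + N * δ i` and `c j + N * δ j` a linear combination of
these transforms and `1`, the transform of `{0}`. By Fourier inversion the convolution equals the
same combination `g` of indicators up to an additive constant. -/
theorem ncard_eq (h : IsAmorphicPartition A κ c N) (i j : Fin (d + 1)) {z z' : V}
    (h0 : z = 0 ↔ z' = 0) (hi : z ∈ A i ↔ z' ∈ A i) (hj : z ∈ A j ↔ z' ∈ A j) :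
    {x | x ∈ A i ∧ z - x ∈ A j}.ncard = {x | x ∈ A i ∧ z' - x ∈ A j}.ncard := by
  classical
  let s : ℂ := if i = j then 1 else 0
  let g : V → ℂ := fun z => (c i + s * N) * (A j).indicator 1 z + c j * (A i).indicator 1 z -
    (c i * c j + s * N * c i) * ({0} : Set V).indicator 1 z
  have hg : g z = g z' := by
    simp only [g, Set.indicator_apply, Pi.one_apply, Set.mem_singleton_iff, h0, hi, hj]
  have h00 : ∀ χ : AddChar V ℂ, charSum ({0} : Set V) χ = 1 := by
    intro χ
    simp [charSum, Set.indicator_apply]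
  have := eq_of_forall_sum_mul_addChar_eq_zero
    (fun z => (({x | x ∈ A i ∧ z - x ∈ A j}.ncard : ℕ) : ℂ) - g z) (fun χ hχ => by
      have e : ∑ z, g z * χ z = (c i + s * N) * charSum (A j) χ + c j * charSum (A i) χ -
          (c i * c j + s * N * c i) * charSum ({0} : Set V) χ := by
        simp only [g, charSum, Finset.mul_sum, ← Finset.sum_add_distrib, ← Finset.sum_sub_distrib]
        exact Finset.sum_congr rfl fun x _ => by ring
      simp only [sub_mul, Finset.sum_sub_distrib, sum_ncard_mul_addChar, e, h00,
        h.charSum_eq χ hχ, s]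
      by_cases hij : i = j
      · subst hij
        by_cases hk : κ χ = i <;> simp [hk] <;> ring
      · by_cases hk : κ χ = i
        · have : κ χ ≠ j := fun hh => hij (hk.symm.trans hh)
          simp only [hij, hk, if_true, if_false]
          ring
        · simp only [hij, hk, if_false]
          ring) z z'
  simp only [hg, sub_left_inj] at this
  exact_mod_cast this

theorem isAssociationScheme (h : IsAmorphicPartition A κ c N) :
    IsAssociationScheme fun i x y => y - x ∈ A i where
  nonempty i := by
    obtain ⟨a, ha⟩ := h.nonempty i
    exact ⟨0, a, by simpa using ha⟩
  partition x y := h.existsUnique _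
  diagonal x y := by rw [h.zero, Set.mem_singleton_iff, sub_eq_zero, eq_comm]
  symmetric i x y hxy := by simpa using h.neg_mem i _ hxy
  intersection i j k := by
    obtain ⟨a, ha⟩ := h.nonempty k
    refine ⟨{x | x ∈ A i ∧ a - x ∈ A j}.ncard, fun x y hxy => ?_⟩
    have hiff : ∀ l, y - x ∈ A l ↔ a ∈ A l := fun l =>
      ⟨fun hl => h.eq_of_mem hxy hl ▸ ha, fun hl => h.eq_of_mem ha hl ▸ hxy⟩
    have h0 := hiff 0
    rw [h.zero, Set.mem_singleton_iff, Set.mem_singleton_iff] at h0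
    rw [← h.ncard_eq i j h0 (hiff i) (hiff j)]
    refine Set.ncard_congr (fun z _ => z - x) ?_ ?_ ?_
    · intro z hz
      exact ⟨hz.1, by simpa using hz.2⟩
    · intro z w _ _ hzw
      simpa using hzw
    · intro w hw
      refine ⟨w + x, ⟨by simpa using hw.1, ?_⟩, by simp⟩
      have := hw.2
      rwa [sub_sub, add_comm x w] at this

/-- The transform of a union is the sum of the transforms, and `N` occurs in it at most once because
`κ χ` lies in a single fibre of `f`. -/
theorem fusion (h : IsAmorphicPartition A κ c N) {d' : ℕ} (f : Fin (d + 1) → Fin (d' + 1))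
    (hf : Function.Surjective f) (hf0 : ∀ i, f i = 0 ↔ i = 0) :
    IsAmorphicPartition (fun j => {x | ∃ i, f i = j ∧ x ∈ A i}) (f ∘ κ)
      (fun j => ∑ i with f i = j, c i) N where
  zero := by
    ext x
    simp [hf0, h.zero]
  nonempty j := by
    obtain ⟨i, rfl⟩ := hf j
    obtain ⟨a, ha⟩ := h.nonempty i
    exact ⟨a, i, rfl, ha⟩
  existsUnique x := by
    obtain ⟨i, hi, -⟩ := h.existsUnique x
    refine ⟨f i, ⟨i, rfl, hi⟩, ?_⟩
    rintro _ ⟨i', rfl, hi'⟩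
    rw [h.eq_of_mem hi hi']
  neg_mem := by
    rintro _ x ⟨i, rfl, hi⟩
    exact ⟨i, rfl, h.neg_mem i x hi⟩
  charSum_eq χ hχ j := by
    classical
    have e : charSum {x | ∃ i, f i = j ∧ x ∈ A i} χ = ∑ i with f i = j, charSum (A i) χ := by
      simp only [charSum]
      rw [Finset.sum_comm]
      refine Finset.sum_congr rfl fun x _ => ?_
      rw [← Finset.sum_mul]
      congr 1
      obtain ⟨i, hi, -⟩ := h.existsUnique x
      have hiff : ∀ k, x ∈ A k ↔ k = i := fun k =>
        ⟨fun hk => h.eq_of_mem hk hi, fun hk => hk ▸ hi⟩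
      simp [Set.indicator_apply, hiff]
    rw [e]
    simp only [h.charSum_eq χ hχ, Finset.sum_add_distrib, Function.comp_apply]
    simp

theorem isAmorphicAssociationScheme (h : IsAmorphicPartition A κ c N) :
    IsAmorphicAssociationScheme fun i x y => y - x ∈ A i :=
  ⟨h.isAssociationScheme, fun _ f hf hf0 => (h.fusion f hf hf0).isAssociationScheme⟩

end IsAmorphicPartition

/-! ### Cayley graphs and strong regularity. -/

theorem addCayley_adj_iff_sub_mem {V : Type*} [AddCommGroup V] {A : Set V} (h0 : 0 ∉ A)
    (hneg : ∀ x ∈ A, -x ∈ A) (x y : V) : (SimpleGraph.addCayley A).Adj x y ↔ y - x ∈ A := by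
  rw [SimpleGraph.addCayley_adj']
  constructor
  · rintro ⟨-, g, hg, rfl | rfl⟩
    · simpa using hg
    · simpa using hneg g hg
  · intro hxy
    refine ⟨?_, y - x, hxy, Or.inl (by abel)⟩
    rintro rfl
    exact h0 (by simpa using hxy)

theorem ncard_setOf_mem_sub_mem_zero {V : Type*} [AddCommGroup V] {A : Set V}
    (hneg : ∀ x ∈ A, -x ∈ A) : {x | x ∈ A ∧ (0 : V) - x ∈ A}.ncard = A.ncard := by
  congr 1
  ext x
  simpa using hneg x

theorem isSRGWith_addCayley_iff {V : Type*} [AddCommGroup V] [Fintype V] {A : Set V}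
    {_ : DecidableRel (SimpleGraph.addCayley A).Adj} (h0 : 0 ∉ A)
    (hneg : ∀ x ∈ A, -x ∈ A) (v k l μ : ℕ) :
    (SimpleGraph.addCayley A).IsSRGWith v k l μ ↔ Fintype.card V = v ∧ A.ncard = k ∧
      (∀ z ∈ A, {x | x ∈ A ∧ z - x ∈ A}.ncard = l) ∧
      ∀ z ∉ A, z ≠ 0 → {x | x ∈ A ∧ z - x ∈ A}.ncard = μ := by
  classical
  have hadj := addCayley_adj_iff_sub_mem h0 hneg
  have hdeg : ∀ x, (SimpleGraph.addCayley A).degree x = A.ncard := by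
    intro x
    rw [← SimpleGraph.card_neighborSet_eq_degree, ← Nat.card_eq_fintype_card,
      Nat.card_coe_set_eq]
    refine Set.ncard_congr (fun z _ => z - x) (fun z hz => (hadj x z).1 hz) ?_ ?_
    · intro z w _ _ hzw
      simpa using hzw
    · intro w hw
      exact ⟨w + x, (hadj _ _).2 (by simpa using hw), by simp⟩
  have hcom : ∀ x y, Fintype.card ((SimpleGraph.addCayley A).commonNeighbors x y) =
      {z | z ∈ A ∧ (y - x) - z ∈ A}.ncard := by
    intro x y
    rw [← Nat.card_eq_fintype_card, Nat.card_coe_set_eq]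
    refine Set.ncard_congr (fun z _ => z - x) ?_ ?_ ?_
    · intro z hz
      rw [SimpleGraph.mem_commonNeighbors, hadj, hadj] at hz
      refine ⟨hz.1, ?_⟩
      simpa using hneg _ hz.2
    · intro z w _ _ hzw
      simpa using hzw
    · intro w hw
      refine ⟨w + x, ?_, by simp⟩
      rw [SimpleGraph.mem_commonNeighbors, hadj, hadj]
      refine ⟨by simpa using hw.1, ?_⟩
      have := hneg _ hw.2
      rwa [neg_sub, sub_sub_eq_add_sub] at this
  constructor
  · intro h
    refine ⟨h.card, (hdeg 0).symm.trans (h.regular 0), fun z hz => ?_, fun z hz hz0 => ?_⟩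
    · have := h.of_adj 0 z ((hadj 0 z).2 (by simpa using hz))
      rw [← this, hcom, sub_zero]
    · have := h.of_not_adj (i := 0) (j := z) hz0.symm (by rw [hadj]; simpa using hz)
      rw [← this, hcom, sub_zero]
  · rintro ⟨hv, hk, hl, hμ⟩
    refine ⟨hv, fun x => (hdeg x).trans hk, fun x y hxy => ?_, fun x y hne hxy => ?_⟩
    · rw [hcom]
      exact hl _ ((hadj x y).1 hxy)
    · rw [hcom]
      exact hμ _ (fun hh => hxy ((hadj x y).2 hh)) (sub_ne_zero.2 hne.symm)

/-- The second nonzero class `A j` supplies a nonzero vector outside `A i`, which fixes `μ` and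
shows that the graph is not complete. -/
theorem IsAmorphicPartition.isStronglyRegular {V : Type*} [AddCommGroup V] [Fintype V] {d : ℕ}
    {A : Fin (d + 1) → Set V} {κ : AddChar V ℂ → Fin (d + 1)} {c : Fin (d + 1) → ℂ} {N : ℂ}
    (h : IsAmorphicPartition A κ c N) {i j : Fin (d + 1)} (hi : i ≠ 0) (hj : j ≠ 0)
    (hij : i ≠ j) : IsStronglyRegular (SimpleGraph.addCayley (A i)) := by
  classical
  have hadj := addCayley_adj_iff_sub_mem (h.zero_notMem hi) (h.neg_mem i)
  obtain ⟨a, ha⟩ := h.nonempty i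
  obtain ⟨b, hb⟩ := h.nonempty j
  have ha0 : a ≠ 0 := fun h0 => h.zero_notMem hi (h0 ▸ ha)
  have hb0 : b ≠ 0 := fun h0 => h.zero_notMem hj (h0 ▸ hb)
  have hbi : b ∉ A i := fun hh => hij (h.eq_of_mem hh hb)
  refine ⟨_, _, _, _, ?_, ?_, (isSRGWith_addCayley_iff (h.zero_notMem hi) (h.neg_mem i) _ _
    {x | x ∈ A i ∧ a - x ∈ A i}.ncard {x | x ∈ A i ∧ b - x ∈ A i}.ncard).2
    ⟨rfl, rfl, fun z hz => ?_, fun z hz hz0 => ?_⟩⟩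
  · intro hbot
    have := (hadj 0 a).2 (by simpa using ha)
    rw [hbot] at this
    exact this
  · intro htop
    have : (SimpleGraph.addCayley (A i)).Adj 0 b := by
      rw [htop]
      exact hb0.symm
    exact hbi (by simpa using (hadj 0 b).1 this)
  · have hz0 : z ≠ 0 := fun h0 => h.zero_notMem hi (h0 ▸ hz)
    exact h.ncard_eq i i (by simp [hz0, ha0]) (by simp [hz, ha]) (by simp [hz, ha])
  · exact h.ncard_eq i i (by simp [hz0, hb0]) (by simp [hz, hbi]) (by simp [hz, hbi])

/-! ### Nondegeneracy of the polar form in even dimension. -/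

/-- In the Leibniz expansion `σ` and `σ⁻¹` give equal terms, which cancel in characteristic two. If
`σ = σ⁻¹`, then `σ` fixes a point of the odd set, and its term contains a zero diagonal entry. -/
theorem Matrix.det_eq_zero_of_alternating_of_odd_card {n R : Type*} [Fintype n] [DecidableEq n]
    [CommRing R] [CharP R 2] (hn : Odd (Fintype.card n)) (A : Matrix n n R)
    (hsymm : ∀ i j, A i j = A j i) (hdiag : ∀ i, A i i = 0) : A.det = 0 := by
  rw [Matrix.det_apply]
  refine Finset.sum_involution (fun σ _ => σ⁻¹) (fun σ _ => ?_) (fun σ _ hσ heq => hσ ?_)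
    (fun _ _ => Finset.mem_univ _) (fun _ _ => inv_inv _)
  · have : ∏ i, A (σ⁻¹ i) i = ∏ i, A (σ i) i := by
      rw [← Equiv.prod_comp σ]
      exact Finset.prod_congr rfl fun i _ => by
        rw [← Equiv.Perm.mul_apply, inv_mul_cancel, Equiv.Perm.one_apply]
        exact hsymm _ _
    rw [this, Equiv.Perm.sign_inv]
    exact CharTwo.add_self_eq_zero _
  · have h2 : σ ^ 2 ^ 1 = 1 := by
      rw [pow_one, pow_two]
      nth_rewrite 1 [← heq]
      exact inv_mul_cancel σ
    have : Fact (Nat.Prime 2) := ⟨Nat.prime_two⟩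
    obtain ⟨a, ha⟩ := Equiv.Perm.exists_fixed_point_of_prime (p := 2) (n := 1)
      (fun h => (Nat.not_even_iff_odd.2 hn) (even_iff_two_dvd.2 h)) h2
    rw [Finset.prod_eq_zero (Finset.mem_univ a) (by rw [ha, hdiag]), smul_zero]

namespace QuadraticMap

/-- A quadratic form with trivial radical on a space of even dimension over a finite field has a
nondegenerate polar form, even in characteristic two. -/
theorem polarBilin_ker_eq_bot_of_even_finrank {K V : Type*} [Field K] [Finite K] [AddCommGroup V]
    [Module K V] [FiniteDimensional K V] (Q : QuadraticForm K V) (hQ : Q.radical = ⊥)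
    (heven : Even (Module.finrank K V)) : Q.polarBilin.ker = ⊥ := by
  by_cases h2 : (2 : K) = 0
  swap
  · have := invertibleOfNonzero h2
    rw [← radical_eq_ker_polarBilin, hQ]
  have : CharP K 2 := CharTwo.of_one_ne_zero_of_two_eq_zero one_ne_zero h2
  set R := Q.polarBilin.ker with hR
  have hpolar : ∀ x ∈ R, ∀ y, polar Q x y = 0 := fun x hx y => by
    have := LinearMap.congr_fun (LinearMap.mem_ker.1 hx) y
    simpa using this
  have hadd : ∀ x ∈ R, ∀ y, Q (x + y) = Q x + Q y := fun x hx y => by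
    rw [QuadraticMap.map_add Q, hpolar x hx y, add_zero]
  have hzero : ∀ x ∈ R, Q x = 0 → x = 0 := by
    intro x hx h0
    rw [← Submodule.mem_bot K, ← hQ, mem_radical_iff']
    exact ⟨h0, fun y => by rw [hadd x hx, h0, zero_add]⟩
  -- On the kernel `Q` is additive with no nonzero zeros. Every scalar is a square, so `Q y = a ^ 2
  -- * Q x` for some `a`, and then `a • x + y` is a zero of `Q`.
  have hle : Module.finrank K R ≤ 1 := by
    by_cases hbot : ∀ x : R, x = 0
    · have : Subsingleton R := ⟨fun x y => (hbot x).trans (hbot y).symm⟩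
      simp [Module.finrank_zero_of_subsingleton]
    push Not at hbot
    obtain ⟨x, hx⟩ := hbot
    have hqx : Q x ≠ 0 := fun h0 => hx (Subtype.ext (hzero x x.2 h0))
    refine finrank_le_one x fun y => ?_
    have hsq : IsSquare (Q (y : V) / Q (x : V)) :=
      FiniteField.isSquare_of_char_two (CharP.ringChar_of_prime_eq_zero Nat.prime_two
        (by exact_mod_cast h2)) _
    obtain ⟨a, ha⟩ := hsq
    refine ⟨a, ?_⟩
    have hmem : a • (x : V) + y ∈ R := R.add_mem (R.smul_mem a x.2) y.2
    have : a • (x : V) + y = 0 := by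
      refine hzero _ hmem ?_
      rw [hadd _ (R.smul_mem a x.2), QuadraticMap.map_smul, ← ha, smul_eq_mul,
        div_mul_cancel₀ _ hqx]
      exact CharTwo.add_self_eq_zero _
    have hneg : (y : V) = -(a • (x : V)) := (neg_eq_of_add_eq_zero_right this).symm
    apply Subtype.ext
    rw [hneg, ← neg_smul, CharTwo.neg_eq]
    rfl
  rcases Nat.le_one_iff_eq_zero_or_eq_one.1 hle with h0 | h1
  · exact Submodule.finrank_eq_zero.1 h0
  -- A complement of a one-dimensional kernel has odd dimension, yet the polar form restricted to it
  -- is nondegenerate and alternating.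
  exfalso
  obtain ⟨W, hW⟩ := Submodule.exists_isCompl R
  have hsum := Submodule.finrank_add_eq_of_isCompl hW
  have hodd : Odd (Module.finrank K W) := by
    rw [h1] at hsum
    rw [← hsum] at heven
    rw [← Nat.not_even_iff_odd]
    intro h
    exact absurd ((Nat.even_add.1 heven).2 h) (by decide)
  have hsymm : LinearMap.IsSymm Q.polarBilin := ⟨fun x y => by simp [polar_comm]⟩
  have hnd := LinearMap.IsSymm.nondegenerate_restrict_of_isCompl_ker hsymm hW.symm
  let b := Module.finBasis K W
  have hdet := (LinearMap.BilinForm.nondegenerate_iff_det_ne_zero b).1 hnd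
  refine hdet (Matrix.det_eq_zero_of_alternating_of_odd_card (by simpa using hodd) _ ?_ ?_)
  · intro i j
    rw [LinearMap.BilinForm.toMatrix_apply, LinearMap.BilinForm.toMatrix_apply]
    exact polar_comm _ _ _
  · intro i
    rw [LinearMap.BilinForm.toMatrix_apply]
    refine (QuadraticMap.polar_self Q _).trans ?_
    rw [two_nsmul, CharTwo.add_self_eq_zero]

theorem polar_left_eq_zero_iff_of_even_finrank {K V : Type*} [Field K] [Finite K] [AddCommGroup V]
    [Module K V] [FiniteDimensional K V] (Q : QuadraticForm K V) (hQ : Q.radical = ⊥)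
    (heven : Even (Module.finrank K V)) (x : V) (h : ∀ y, polar Q x y = 0) : x = 0 := by
  rw [← Submodule.mem_bot K, ← Q.polarBilin_ker_eq_bot_of_even_finrank hQ heven,
    LinearMap.mem_ker]
  ext y
  simpa using h y

/-- A quadratic form with nondegenerate polar form that has a nontrivial zero is surjective; every
nonzero value is taken. -/
theorem surjective_of_isotropic {K V : Type*} [Field K] [AddCommGroup V] [Module K V]
    (Q : QuadraticForm K V) (hpol : ∀ x, (∀ y, polar Q x y = 0) → x = 0)
    (hiso : ∃ x, x ≠ 0 ∧ Q x = 0) : Function.Surjective Q := by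
  obtain ⟨x, hx, hQx⟩ := hiso
  have : ∃ y, polar Q x y ≠ 0 := by
    by_contra! h
    exact hx (hpol x h)
  obtain ⟨y, hy⟩ := this
  intro a
  -- Since `Q x = 0`, the form is affine with nonzero slope along the line `y + K x`.
  refine ⟨((a - Q y) / polar Q x y) • x + y, ?_⟩
  rw [QuadraticMap.map_add Q, QuadraticMap.map_smul, hQx, polar_smul_left, smul_zero, smul_eq_mul,
    div_mul_cancel₀ _ hy]
  ring

end QuadraticMap

/-! ### Gauss sums, and Fourier coefficients of level sets as Kloosterman sums. -/

section GaussSum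

/-- The character `x ↦ ψ (B (b, x))`, where `B` is the polar form of `Q`. -/
def polarChar {K V : Type*} [Field K] [AddCommGroup V] [Module K V] (ψ : AddChar K ℂ) (Q : QuadraticForm K V) (b : V) : AddChar V ℂ :=
  ψ.compAddMonoidHom (Q.polarBilin b).toAddMonoidHom

theorem polarChar_apply {K V : Type*} [Field K] [AddCommGroup V] [Module K V] (ψ : AddChar K ℂ) (Q : QuadraticForm K V) (b x : V) :
    polarChar ψ Q b x = ψ (QuadraticMap.polar Q b x) := rfl

theorem polarChar_zero {K V : Type*} [Field K] [AddCommGroup V] [Module K V] (ψ : AddChar K ℂ) (Q : QuadraticForm K V) : polarChar ψ Q 0 = 0 := by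
  ext x
  simp [polarChar_apply]

variable {K V : Type*} [Field K] [Fintype K] [AddCommGroup V] [Fintype V] [Module K V]

theorem sum_addChar_mul {ψ : AddChar K ℂ} (hψ : ψ.IsPrimitive) [DecidableEq K] (a : K) :
    ∑ t, ψ (t * a) = if a = 0 then (Fintype.card K : ℂ) else 0 := by
  rw [AddChar.sum_mulShift a hψ]
  push_cast
  rfl

/-- One-variable quadratic Gauss sums scale by the quadratic character. -/
theorem sum_addChar_mul_mul_self [DecidableEq K] (hK : ringChar K ≠ 2) {ψ : AddChar K ℂ}
    (hψ : ψ.IsPrimitive) {a : K} (ha : a ≠ 0) {t : K} (ht : t ≠ 0) :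
    ∑ x, ψ (t * (a * (x * x))) = (quadraticChar K t : ℂ) * ∑ x, ψ (a * (x * x)) := by
  -- An element `y` has `1 + quadraticChar K y` square roots, and the contribution of the `1` sums
  -- to zero.
  have key : ∀ b : K, b ≠ 0 →
      ∑ x, ψ (b * (x * x)) = ∑ y, (quadraticChar K y : ℂ) * ψ (y * b) := by
    intro b hb
    have h1 : ∑ x, ψ (b * (x * x)) = ∑ y, ∑ x with x ^ 2 = y, ψ (y * b) := by
      rw [← Finset.sum_fiberwise (g := fun x : K => x ^ 2)]
      refine Finset.sum_congr rfl fun y _ => Finset.sum_congr rfl fun x hx => ?_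
      rw [← (Finset.mem_filter.1 hx).2]
      ring_nf
    rw [h1]
    have h2 : ∀ y : K, (((Finset.univ.filter fun x : K => x ^ 2 = y).card : ℕ) : ℂ) =
        (quadraticChar K y : ℂ) + 1 := by
      intro y
      have := quadraticChar_card_sqrts hK y
      have e : {x : K | x ^ 2 = y}.toFinset = Finset.univ.filter fun x : K => x ^ 2 = y := by
        ext; simp
      rw [e] at this
      exact_mod_cast congrArg (Int.cast : ℤ → ℂ) this
    simp only [Finset.sum_const, nsmul_eq_mul, h2, add_mul, one_mul, Finset.sum_add_distrib]
    rw [sum_addChar_mul hψ, if_neg hb, add_zero]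
  have e : ∀ x : K, t * (a * (x * x)) = t * a * (x * x) := fun x => by ring
  simp only [e]
  rw [key a ha, key _ (mul_ne_zero ht ha), Finset.mul_sum,
    ← Equiv.sum_comp (Equiv.mulRight₀ t ht)
      (fun y => (quadraticChar K t : ℂ) * ((quadraticChar K y : ℂ) * ψ (y * a)))]
  refine Finset.sum_congr rfl fun y _ => ?_
  have hsq : (quadraticChar K t : ℂ) * (quadraticChar K t : ℂ) = 1 := by
    have := quadraticChar_sq_one ht
    rw [pow_two] at this
    exact_mod_cast this
  simp only [Equiv.mulRight₀_apply, map_mul, Int.cast_mul]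
  rw [mul_assoc y t a]
  linear_combination (-(quadraticChar K y : ℂ) * ψ (y * (t * a))) * hsq

/-- The Gauss sum of a quadratic form with trivial radical on an even-dimensional space does not
change when the form is multiplied by a nonzero scalar. -/
theorem sum_addChar_mul_quadraticForm (Q : QuadraticForm K V) (hQ : Q.radical = ⊥)
    (heven : Even (Module.finrank K V)) {ψ : AddChar K ℂ} (hψ : ψ.IsPrimitive) {t : K}
    (ht : t ≠ 0) : ∑ x, ψ (t * Q x) = ∑ x, ψ (Q x) := by
  classical
  by_cases hK : ringChar K = 2
  · obtain ⟨s, rfl⟩ := FiniteField.isSquare_of_char_two hK t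
    have hs : s ≠ 0 := fun h => ht (by simp [h])
    rw [← Equiv.sum_comp (LinearEquiv.smulOfNeZero K V s hs).toEquiv (fun x => ψ (Q x))]
    refine Finset.sum_congr rfl fun x _ => ?_
    simp [QuadraticMap.map_smul]
  have h2 : (2 : K) ≠ 0 := Ring.two_ne_zero hK
  have := invertibleOfNonzero h2
  have hnd : LinearMap.SeparatingLeft (QuadraticMap.associated (R := K) Q) := by
    rw [LinearMap.separatingLeft_iff_ker_eq_bot, ← QuadraticMap.radical_eq_ker_associated, hQ]
  obtain ⟨w, ⟨f⟩⟩ := QuadraticForm.equivalent_weightedSumSquares_units_of_nondegenerate' Q hnd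
  -- After diagonalization the sum factors into one-variable Gauss sums. Each is scaled by the
  -- quadratic character of `t`, and the number of factors is even.
  have hprod : ∀ s : K, ∑ x, ψ (s * Q x) = ∏ i, ∑ x : K, ψ (s * ((w i : K) * (x * x))) := by
    intro s
    rw [Finset.prod_univ_sum, Fintype.piFinset_univ, ← Equiv.sum_comp f.toLinearEquiv.toEquiv]
    refine Finset.sum_congr rfl fun x _ => ?_
    rw [← f.map_app, QuadraticMap.weightedSumSquares_apply, Finset.mul_sum]
    have : ∀ (S : Finset (Fin (Module.finrank K V))) (g : Fin (Module.finrank K V) → K),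
        ψ (∑ i ∈ S, g i) = ∏ i ∈ S, ψ (g i) := by
      intro S g
      induction S using Finset.induction_on with
      | empty => simp
      | insert a S ha ih => rw [Finset.sum_insert ha, Finset.prod_insert ha,
          AddChar.map_add_eq_mul, ih]
    rw [this]
    rfl
  have h1 := hprod 1
  simp only [one_mul] at h1
  rw [hprod t, h1]
  simp only [fun i => sum_addChar_mul_mul_self hK hψ (w i).ne_zero ht]
  rw [Finset.prod_mul_distrib, Finset.prod_const, Finset.card_univ, Fintype.card_fin]
  have hsq : (quadraticChar K t : ℂ) ^ Module.finrank K V = 1 := by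
    obtain ⟨k, hk⟩ := heven
    rw [hk, ← two_mul, pow_mul]
    have : (quadraticChar K t : ℂ) ^ 2 = 1 := by exact_mod_cast quadraticChar_sq_one ht
    rw [this, one_pow]
  rw [hsq, one_mul]

theorem polarChar_injective {K V : Type*} [Field K] [AddCommGroup V] [Module K V]
    {ψ : AddChar K ℂ} (hψ : ψ.IsPrimitive) {Q : QuadraticForm K V}
    (hpol : ∀ x, (∀ y, QuadraticMap.polar Q x y = 0) → x = 0) :
    Function.Injective (polarChar ψ Q) := by
  intro a b hab
  rw [← sub_eq_zero]
  refine hpol _ fun y => ?_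
  by_contra hne
  obtain ⟨t, ht⟩ := AddChar.ne_one_iff.1 (hψ hne)
  apply ht
  have h := DFunLike.congr_fun hab (t • y)
  rw [polarChar_apply, polarChar_apply, QuadraticMap.polar_smul_right,
    QuadraticMap.polar_smul_right] at h
  rw [AddChar.mulShift_apply, QuadraticMap.polar_sub_left, mul_comm, mul_sub,
    AddChar.map_sub_eq_div, ← smul_eq_mul, ← smul_eq_mul, h]
  exact div_self (AddChar.val_isUnit ψ _).ne_zero

theorem polarChar_bijective {K V : Type*} [Field K] [AddCommGroup V] [Fintype V] [Module K V]
    {ψ : AddChar K ℂ} (hψ : ψ.IsPrimitive) {Q : QuadraticForm K V}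
    (hpol : ∀ x, (∀ y, QuadraticMap.polar Q x y = 0) → x = 0) :
    Function.Bijective (polarChar ψ Q) :=
  (Fintype.bijective_iff_injective_and_card _).2 ⟨polarChar_injective hψ hpol, by simp⟩

/-- Completing the square: the substitution `x ↦ x + t⁻¹ • b` absorbs the linear term. -/
theorem sum_addChar_mul_polarChar {K V : Type*} [Field K] [AddCommGroup V] [Fintype V]
    [Module K V] (ψ : AddChar K ℂ) (Q : QuadraticForm K V) (b : V) {t : K} (ht : t ≠ 0) : ∑ x, ψ (t * Q x) * polarChar ψ Q b x =
      ψ (-(t⁻¹ * Q b)) * ∑ x, ψ (t * Q x) := by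
  rw [← Equiv.sum_comp (Equiv.addLeft (t⁻¹ • b)) (fun x => ψ (t * Q x)), Finset.mul_sum]
  refine Finset.sum_congr rfl fun x _ => ?_
  rw [polarChar_apply, ← AddChar.map_add_eq_mul, ← AddChar.map_add_eq_mul, Equiv.coe_addLeft,
    QuadraticMap.map_add Q, QuadraticMap.map_smul, QuadraticMap.polar_smul_left]
  congr 1
  simp only [smul_eq_mul]
  field_simp
  ring

open scoped Classical in
/-- The sum of the Kloosterman sums `∑ t, ψ (-(t y) - s / t)` over all `y ∈ X`. -/
noncomputable def kloostermanSum (ψ : AddChar K ℂ) (X : Set K) (s : K) : ℂ :=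
  ∑ y, X.indicator 1 y * ∑ t ∈ Finset.univ.erase 0, ψ (-(t * y)) * ψ (-(t⁻¹ * s))

/-- The condition `Q x = y` is detected by the average of `ψ (t * (Q x - y))` over `t`. The term `t
= 0` gives the first summand; the terms `t ≠ 0` are evaluated by completing the square. -/
theorem card_mul_charSum_levelSet {ψ : AddChar K ℂ} (hψ : ψ.IsPrimitive) (Q : QuadraticForm K V)
    {G : ℂ} (hG : ∀ t : K, t ≠ 0 → ∑ x, ψ (t * Q x) = G) (X : Set K) (b : V) :
    (Fintype.card K : ℂ) * charSum (levelSet Q X) (polarChar ψ Q b) =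
      X.ncard * ∑ x, polarChar ψ Q b x + G * kloostermanSum ψ X (Q b) := by
  classical
  have h1 : ∀ x, (Fintype.card K : ℂ) * (levelSet Q X).indicator 1 x =
      ∑ y, X.indicator 1 y * ∑ t, ψ (t * (Q x - y)) := by
    intro x
    simp only [sum_addChar_mul hψ, sub_eq_zero, mul_ite, mul_zero]
    rw [Finset.sum_ite_eq Finset.univ (Q x)]
    simp [levelSet, Set.indicator_apply]
  have h2 : ∀ y, X.indicator (1 : K → ℂ) y * ∑ x, polarChar ψ Q b x +
      G * (X.indicator 1 y * ∑ t ∈ Finset.univ.erase 0, ψ (-(t * y)) * ψ (-(t⁻¹ * Q b))) =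
      ∑ x, X.indicator 1 y * (∑ t, ψ (t * (Q x - y))) * polarChar ψ Q b x := by
    intro y
    have : ∑ x, (∑ t, ψ (t * (Q x - y))) * polarChar ψ Q b x =
        ∑ t, ψ (-(t * y)) * ∑ x, ψ (t * Q x) * polarChar ψ Q b x := by
      simp only [Finset.sum_mul, Finset.mul_sum]
      rw [Finset.sum_comm]
      refine Finset.sum_congr rfl fun t _ => Finset.sum_congr rfl fun x _ => ?_
      rw [mul_sub, sub_eq_add_neg, AddChar.map_add_eq_mul]
      ring
    simp only [mul_assoc]
    rw [← Finset.mul_sum, this, ← Finset.add_sum_erase _ _ (Finset.mem_univ (0 : K))]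
    simp only [zero_mul, neg_zero, AddChar.map_zero_eq_one, one_mul]
    rw [mul_add, mul_left_comm G, Finset.mul_sum _ _ G]
    congr 2
    refine Finset.sum_congr rfl fun t ht => ?_
    have ht0 := Finset.ne_of_mem_erase ht
    rw [sum_addChar_mul_polarChar ψ Q b ht0, hG t ht0]
    ring
  have h3 : (X.ncard : ℂ) = ∑ y, X.indicator (1 : K → ℂ) y := by
    simp [Set.indicator_apply, Set.ncard_eq_toFinset_card', Finset.sum_boole]
  rw [charSum, Finset.mul_sum, kloostermanSum, h3, Finset.sum_mul, Finset.mul_sum,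
    ← Finset.sum_add_distrib, Finset.sum_congr rfl fun y _ => h2 y, Finset.sum_comm]
  refine Finset.sum_congr rfl fun x _ => ?_
  rw [← mul_assoc, h1, Finset.sum_mul]

theorem kloostermanSum_zero {ψ : AddChar K ℂ} (hψ : ψ.IsPrimitive) {X : Set K} (h0 : 0 ∉ X) :
    kloostermanSum ψ X 0 = -X.ncard := by
  classical
  have h3 : (X.ncard : ℂ) = ∑ y, X.indicator (1 : K → ℂ) y := by
    simp [Set.indicator_apply, Set.ncard_eq_toFinset_card', Finset.sum_boole]
  rw [h3, kloostermanSum, ← Finset.sum_neg_distrib]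
  refine Finset.sum_congr rfl fun y _ => ?_
  by_cases hy : y ∈ X
  · have hy0 : y ≠ 0 := fun h => h0 (h ▸ hy)
    have := sum_addChar_mul hψ (-y)
    rw [← Finset.add_sum_erase _ _ (Finset.mem_univ (0 : K)), if_neg (neg_ne_zero.2 hy0)] at this
    simp only [zero_mul, AddChar.map_zero_eq_one, mul_neg, neg_zero] at this
    simp only [Set.indicator_of_mem hy, Pi.one_apply, mul_zero, neg_zero,
      AddChar.map_zero_eq_one, mul_one, one_mul]
    exact (neg_eq_of_add_eq_zero_right this).symm
  · simp [hy]

theorem kloostermanSum_singleton_zero {ψ : AddChar K ℂ} (hψ : ψ.IsPrimitive) [DecidableEq K]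
    (s : K) : kloostermanSum ψ {0} s = (if s = 0 then (Fintype.card K : ℂ) else 0) - 1 := by
  have h := sum_addChar_mul hψ (-s)
  -- The substitution `t ↦ t⁻¹` fixes `0` because `0⁻¹ = 0`, so the full character sum is the
  -- Kloosterman sum plus the term `1` at `t = 0`.
  rw [← Equiv.sum_comp (Equiv.inv K), ← Finset.add_sum_erase _ _ (Finset.mem_univ (0 : K))] at h
  simp only [Equiv.inv_apply, inv_zero, zero_mul, mul_neg, neg_zero, AddChar.map_zero_eq_one,
    neg_eq_zero] at h
  rw [← h, add_sub_cancel_left, kloostermanSum, Finset.sum_eq_single 0]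
  · simp only [Set.indicator_of_mem (Set.mem_singleton (0 : K)), Pi.one_apply, mul_zero, neg_zero,
      AddChar.map_zero_eq_one, one_mul]
    exact Finset.sum_congr (by ext; simp) fun _ _ => rfl
  · intro y _ hy
    simp [hy]
  · simp

theorem kloostermanSum_univ {ψ : AddChar K ℂ} (hψ : ψ.IsPrimitive) (s : K) :
    kloostermanSum ψ Set.univ s = 0 := by
  classical
  simp only [kloostermanSum, Set.indicator_univ, Pi.one_apply, one_mul]
  rw [Finset.sum_comm]
  refine Finset.sum_eq_zero fun t ht => ?_
  rw [← Finset.sum_mul]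
  have := sum_addChar_mul hψ (-t)
  rw [if_neg (neg_ne_zero.2 (Finset.ne_of_mem_erase ht))] at this
  have e : ∑ y, ψ (-(t * y)) = 0 := by
    rw [← this]
    exact Finset.sum_congr rfl fun y _ => by ring_nf
  rw [e, zero_mul]

theorem kloostermanSum_union (ψ : AddChar K ℂ) {X Y : Set K} (h : Disjoint X Y) (s : K) :
    kloostermanSum ψ (X ∪ Y) s = kloostermanSum ψ X s + kloostermanSum ψ Y s := by
  simp only [kloostermanSum, ← Finset.sum_add_distrib, ← add_mul]
  refine Finset.sum_congr rfl fun y _ => ?_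
  rw [Set.indicator_union_of_disjoint h]

end GaussSum

/-! ### The norm form of a quadratic extension. -/

section NormForm

variable {K L : Type*} [Field K] [Fintype K] [Field L] [Fintype L] [Algebra K L]

theorem algebraMap_norm_of_finrank_eq_two (hKL : Module.finrank K L = 2) (x : L) :
    algebraMap K L (Algebra.norm K x) = x * FiniteField.frobeniusAlgHom K L x := by
  rw [FiniteField.algebraMap_norm_eq_prod_pow, hKL, Finset.prod_range_succ, Finset.prod_range_one,
    pow_zero, pow_one, pow_one, FiniteField.coe_frobeniusAlgHom, Nat.card_eq_fintype_card]

theorem algebraMap_polar_norm (hKL : Module.finrank K L = 2) (x y : L) :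
    algebraMap K L (QuadraticMap.polar (Algebra.norm K) x y) =
      x * FiniteField.frobeniusAlgHom K L y + y * FiniteField.frobeniusAlgHom K L x := by
  simp only [QuadraticMap.polar, map_sub, algebraMap_norm_of_finrank_eq_two hKL, map_add]
  ring

/-- The norm of a quadratic extension of finite fields, as a quadratic form. -/
noncomputable def normForm (hKL : Module.finrank K L = 2) : QuadraticForm K L :=
  QuadraticMap.ofPolar (Algebra.norm K)
    (fun a x => by
      rw [Algebra.smul_def, map_mul, Algebra.norm_algebraMap, hKL, pow_two, smul_eq_mul])
    (fun x x' y => (algebraMap K L).injective (by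
      simp only [map_add, algebraMap_polar_norm hKL]
      ring))
    (fun a x y => (algebraMap K L).injective (by
      simp only [smul_eq_mul, map_mul, algebraMap_polar_norm hKL, map_smul]
      simp only [Algebra.smul_def]
      ring))

theorem normForm_apply (hKL : Module.finrank K L = 2) (x : L) :
    normForm hKL x = Algebra.norm K x := rfl

theorem polar_normForm_nondegenerate (hKL : Module.finrank K L = 2) (x : L)
    (h : ∀ y, QuadraticMap.polar (normForm hKL) x y = 0) : x = 0 := by
  by_contra hx
  have htr : ∀ y : L, Algebra.trace K L y = 0 := by
    intro y
    apply (algebraMap K L).injective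
    -- The polar form at `x` and `x * y` is the norm of `x` times the trace of `y`.
    have h1 := congrArg (algebraMap K L) (h (x * y))
    have h2 := algebraMap_polar_norm hKL x (x * y)
    have h3 : FiniteField.frobeniusAlgHom K L x ≠ 0 := by simpa using hx
    rw [FiniteField.algebraMap_trace_eq_sum_pow, hKL, Finset.sum_range_succ, Finset.sum_range_one,
      pow_zero, pow_one, pow_one, map_zero, Nat.card_eq_fintype_card]
    have h4 : y ^ Fintype.card K = FiniteField.frobeniusAlgHom K L y := rfl
    rw [h4]
    rw [map_zero] at h1
    have h5 := h2.symm.trans h1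
    rw [map_mul] at h5
    refine (mul_eq_zero.1 (?_ : x * FiniteField.frobeniusAlgHom K L x * _ = 0)).resolve_left
      (mul_ne_zero hx h3)
    linear_combination h5
  exact Algebra.trace_ne_zero K L (LinearMap.ext htr)

/-- Norms are multiplicative and surjective, so the sum is the same number `G` for all `t ≠ 0`.
Summing over all `t` counts the zeros of the norm, of which there is one: `q ^ 2 + (q - 1) * G = q`.
-/
theorem sum_addChar_mul_normForm (hKL : Module.finrank K L = 2) {ψ : AddChar K ℂ}
    (hψ : ψ.IsPrimitive) (t : K) (ht : t ≠ 0) :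
    ∑ x, ψ (t * normForm hKL x) = -Fintype.card K := by
  classical
  have hconst : ∀ t : K, t ≠ 0 → ∑ x, ψ (t * normForm hKL x) = ∑ x, ψ (normForm hKL x) := by
    intro t ht
    obtain ⟨a, rfl⟩ := FiniteField.norm_surjective K L t
    have ha : a ≠ 0 := fun h => ht (by rw [h, Algebra.norm_zero])
    rw [← Equiv.sum_comp (Equiv.mulLeft₀ a ha) (fun x => ψ (normForm hKL x))]
    refine Finset.sum_congr rfl fun x _ => ?_
    rw [normForm_apply, normForm_apply, ← map_mul (Algebra.norm K)]
    rfl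
  have h1 : ∑ t, ∑ x, ψ (t * normForm hKL x) = (Fintype.card K : ℂ) := by
    rw [Finset.sum_comm]
    simp [sum_addChar_mul hψ, normForm_apply, Algebra.norm_eq_zero_iff]
  rw [← Finset.add_sum_erase _ _ (Finset.mem_univ (0 : K)),
    Finset.sum_congr rfl fun t ht => hconst t (Finset.ne_of_mem_erase ht), Finset.sum_const,
    Finset.card_erase_of_mem (Finset.mem_univ _), Finset.card_univ, nsmul_eq_mul,
    Nat.cast_sub Fintype.card_pos] at h1
  simp only [zero_mul, AddChar.map_zero_eq_one, Finset.sum_const, Finset.card_univ,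
    nsmul_eq_mul, mul_one, Module.card_eq_pow_finrank (K := K) (V := L), hKL, Nat.cast_pow,
    Nat.cast_one] at h1
  rw [hconst t ht]
  have hq : (Fintype.card K : ℂ) - 1 ≠ 0 := by
    rw [sub_ne_zero]
    exact_mod_cast Fintype.one_lt_card.ne'
  apply mul_left_cancel₀ hq
  linear_combination h1

theorem charSum_levelSet_normForm (hKL : Module.finrank K L = 2) {ψ : AddChar K ℂ}
    (hψ : ψ.IsPrimitive) (X : Set K) {b : L} (hb : b ≠ 0) :
    charSum (levelSet (normForm hKL) X) (polarChar ψ (normForm hKL) b) =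
      -kloostermanSum ψ X (Algebra.norm K b) := by
  have h := card_mul_charSum_levelSet hψ (normForm hKL) (sum_addChar_mul_normForm hKL hψ) X b
  have hχ : polarChar ψ (normForm hKL) b ≠ 0 := fun h0 => hb
    (polarChar_injective hψ (polar_normForm_nondegenerate hKL) (h0.trans (polarChar_zero _ _).symm))
  rw [AddChar.sum_eq_zero_iff_ne_zero.2 hχ, normForm_apply, mul_zero, zero_add] at h
  have hq : (Fintype.card K : ℂ) ≠ 0 := by simp
  apply mul_left_cancel₀ hq
  rw [h]
  ring

theorem ncard_levelSet_normForm (hKL : Module.finrank K L = 2) {X : Set K} (hX : 0 ∉ X) :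
    (levelSet (normForm hKL) X).ncard = X.ncard * (Fintype.card K + 1) := by
  have hψ := AddChar.FiniteField.primitiveChar_to_Complex_isPrimitive K
  have h := card_mul_charSum_levelSet hψ (normForm hKL) (sum_addChar_mul_normForm hKL hψ) X 0
  rw [polarChar_zero, charSum_zero, QuadraticMap.map_zero, kloostermanSum_zero hψ hX] at h
  simp only [AddChar.zero_apply, Finset.sum_const, Finset.card_univ, nsmul_eq_mul, mul_one,
    Module.card_eq_pow_finrank (K := K) (V := L), hKL, Nat.cast_pow] at h
  have hq : (Fintype.card K : ℂ) ≠ 0 := by simp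
  have : ((levelSet (normForm hKL) X).ncard : ℂ) = X.ncard * (Fintype.card K + 1) := by
    apply mul_left_cancel₀ hq
    rw [h]
    ring
  exact_mod_cast this

end NormForm

/-! ### From the given strongly regular graph to the values of the Kloosterman sums. -/

theorem zero_notMem_levelSet {K V : Type*} [Field K] [AddCommGroup V] [Module K V]
    (Q : QuadraticForm K V) {X : Set K} (hX : 0 ∉ X) : (0 : V) ∉ levelSet Q X := by
  simpa [levelSet] using hX

theorem neg_mem_levelSet {K V : Type*} [Field K] [AddCommGroup V] [Module K V]
    (Q : QuadraticForm K V) (X : Set K) (x : V) (hx : x ∈ levelSet Q X) : -x ∈ levelSet Q X := by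
  simpa [levelSet] using hx

/-- A nontrivial Fourier coefficient of the connection set of a strongly regular Cayley graph is a
root of the quadratic polynomial given by the parameters of the graph. -/
theorem sq_charSum_of_isSRGWith {V : Type*} [AddCommGroup V] [Fintype V] {A : Set V}
    {_ : DecidableRel (SimpleGraph.addCayley A).Adj} (h0 : 0 ∉ A) (hneg : ∀ x ∈ A, -x ∈ A)
    {v k l μ : ℕ} (h : (SimpleGraph.addCayley A).IsSRGWith v k l μ) {χ : AddChar V ℂ}
    (hχ : χ ≠ 0) : charSum A χ ^ 2 = (k - μ) + (l - μ) * charSum A χ := by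
  classical
  obtain ⟨-, hk, hl, hμ⟩ := (isSRGWith_addCayley_iff h0 hneg v k l μ).1 h
  -- The convolution square of the indicator of `A` is the constant `μ` plus multiples of two
  -- indicators; a nontrivial character kills the constant.
  have hn : ∀ z, (({x | x ∈ A ∧ z - x ∈ A}.ncard : ℕ) : ℂ) =
      μ + ((k - μ) * (if z = 0 then 1 else 0) + (l - μ) * A.indicator 1 z) := by
    intro z
    by_cases hz0 : z = 0
    · subst hz0
      rw [ncard_setOf_mem_sub_mem_zero hneg, hk]
      simp [h0]
    · by_cases hz : z ∈ A
      · simp [hl z hz, hz, hz0]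
      · simp [hμ z hz hz0, hz, hz0]
  rw [pow_two, ← sum_ncard_mul_addChar]
  simp only [hn, add_mul, Finset.sum_add_distrib, mul_assoc, ← Finset.mul_sum]
  rw [AddChar.sum_eq_zero_iff_ne_zero.2 hχ]
  simp [charSum]

/-- The vertex count and the degree force `n = q` and `r = |X|`. With these parameters the
nontrivial eigenvalues are `r` and `r - n`, and the Kloosterman sums are their negatives.
Surjectivity of the norm reaches every `s ≠ 0`. -/
theorem kloostermanSum_eq_or_eq {K L : Type*} [Field K] [Fintype K] [Field L] [Fintype L]
    [Algebra K L] (hKL : Module.finrank K L = 2) {X : Set K} (hX : 0 ∉ X)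
    (hsrg : IsNegativeLatinSquareType (SimpleGraph.addCayley (levelSet (normForm hKL) X)))
    {ψ : AddChar K ℂ} (hψ : ψ.IsPrimitive) (s : K) :
    kloostermanSum ψ X s = -X.ncard ∨ kloostermanSum ψ X s = Fintype.card K - X.ncard := by
  obtain rfl | hs := eq_or_ne s 0
  · exact Or.inl (kloostermanSum_zero hψ hX)
  obtain ⟨n, r, l, hl, -, -, h⟩ := hsrg
  have h0 := zero_notMem_levelSet (normForm hKL) hX
  have hneg := neg_mem_levelSet (normForm hKL) X
  obtain ⟨hv, hk, -, -⟩ := (isSRGWith_addCayley_iff h0 hneg _ _ _ _).1 h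
  rw [Module.card_eq_pow_finrank (K := K) (V := L), hKL] at hv
  have hn : Fintype.card K = n := Nat.pow_left_injective two_ne_zero hv
  rw [ncard_levelSet_normForm hKL hX, hn] at hk
  have hr : X.ncard = r := Nat.eq_of_mul_eq_mul_right (Nat.succ_pos n) hk
  obtain ⟨b, rfl⟩ := FiniteField.norm_surjective K L s
  have hb : b ≠ 0 := fun hb => hs (by rw [hb, Algebra.norm_zero])
  have hχ : polarChar ψ (normForm hKL) b ≠ 0 := fun h0 => hb
    (polarChar_injective hψ (polar_normForm_nondegenerate hKL) (h0.trans (polarChar_zero _ _).symm))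
  have hsq := sq_charSum_of_isSRGWith h0 hneg h hχ
  rw [charSum_levelSet_normForm hKL hψ X hb] at hsq
  have hl' : (l : ℂ) = -n + r ^ 2 + 3 * r := by exact_mod_cast congrArg (Int.cast : ℤ → ℂ) hl
  rw [hl'] at hsq
  push_cast at hsq
  rw [hr, hn]
  set f := kloostermanSum ψ X (Algebra.norm K b)
  have : (f + r) * (f - (n - r)) = 0 := by linear_combination hsq
  rcases mul_eq_zero.1 this with h1 | h1
  · exact Or.inl (eq_neg_of_add_eq_zero_left h1)
  · exact Or.inr (sub_eq_zero.1 h1)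

theorem zero_notMem_cyclotomicClass {F : Type*} [Field F] (γ : Fˣ) (e i : ℕ) :
    (0 : F) ∉ cyclotomicClass γ e i := by
  rintro ⟨u, -, hu⟩
  exact (γ ^ i * u).ne_zero hu.symm

/-- Both memberships say that the discrete logarithm of `x` to base `γ` is `i` modulo `e`. For the
norm this logarithm is known only modulo `q - 1`, the order of `ω`, which suffices because `e`
divides `q - 1`. -/
theorem mem_cyclotomicClass_iff_norm_mem {K L : Type*} [Field K] [Fintype K] [Field L] [Fintype L]
    [Algebra K L] {e : ℕ} (hdvd : e ∣ Fintype.card K - 1) {γ : Lˣ}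
    (hγ : ∀ u : Lˣ, u ∈ Subgroup.zpowers γ) (i : ℕ) (x : L) :
    x ∈ cyclotomicClass γ e i ↔
      Algebra.norm K x ∈ cyclotomicClass (Units.map (Algebra.norm K) γ : Kˣ) e i := by
  set ω : Kˣ := Units.map (Algebra.norm K) γ with hω
  constructor
  · rintro ⟨u, hu, rfl⟩
    obtain ⟨k, rfl⟩ := Subgroup.mem_zpowers_iff.1 hu
    refine ⟨(ω ^ e) ^ k, Subgroup.zpow_mem_zpowers _ _, ?_⟩
    rw [hω, ← map_pow, ← map_pow, ← map_zpow, ← map_mul]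
    rfl
  · rintro ⟨u, hu, hx⟩
    obtain ⟨k, rfl⟩ := Subgroup.mem_zpowers_iff.1 hu
    have hx0 : x ≠ 0 := by
      rintro rfl
      rw [Algebra.norm_zero] at hx
      exact (ω ^ i * (ω ^ e) ^ k).ne_zero hx.symm
    obtain ⟨j, hj⟩ := Subgroup.mem_zpowers_iff.1 (hγ (Units.mk0 x hx0))
    have hxj : x = ((γ ^ j : Lˣ) : L) := by rw [hj, Units.val_mk0]
    have hgen : ∀ u : Kˣ, u ∈ Subgroup.zpowers ω := by
      intro u
      obtain ⟨y, rfl⟩ := FiniteField.unitsMap_norm_surjective K L u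
      obtain ⟨a, rfl⟩ := Subgroup.mem_zpowers_iff.1 (hγ y)
      exact ⟨a, by simp [hω]⟩
    have hord : orderOf ω = Fintype.card K - 1 := by
      rw [orderOf_eq_card_of_forall_mem_zpowers hgen, Nat.card_units, Nat.card_eq_fintype_card]
    have hpow : ω ^ j = ω ^ ((i : ℤ) + e * k) := by
      have h1 : ω ^ j = ω ^ i * (ω ^ e) ^ k := by
        apply Units.ext
        rw [← hx, hxj, hω, ← map_zpow]
        rfl
      rw [h1, zpow_add, zpow_mul, zpow_natCast, zpow_natCast]
    rw [zpow_eq_zpow_iff_modEq, hord] at hpow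
    have he : (e : ℤ) ∣ j - i := by
      have h1 := (Int.natCast_dvd_natCast.2 hdvd).trans hpow.symm.dvd
      have h2 := dvd_add h1 (dvd_mul_right (e : ℤ) k)
      have h3 : j - ((i : ℤ) + e * k) + e * k = j - i := by ring
      rwa [h3] at h2
    obtain ⟨a, ha⟩ := he
    refine ⟨(γ ^ e) ^ a, Subgroup.zpow_mem_zpowers _ _, ?_⟩
    rw [hxj, show j = (i : ℤ) + e * a by linarith, zpow_add, zpow_mul, zpow_natCast, zpow_natCast]

/-! ### Transfer to the form `Q`, and the main theorem. -/

/-- If the Kloosterman sums of `E` take only two values, differing by the size of the field, then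
the preimages of `E`, of its complement and of `0` under an isotropic nondegenerate quadratic form
form an amorphic partition. -/
theorem exists_isAmorphicPartition {K V : Type*} [Field K] [Fintype K] [AddCommGroup V]
    [Fintype V] [Module K V] {ψ : AddChar K ℂ} (hψ : ψ.IsPrimitive) (Q : QuadraticForm K V)
    {G : ℂ} (hG : ∀ t : K, t ≠ 0 → ∑ x, ψ (t * Q x) = G)
    (hpol : ∀ x, (∀ y, QuadraticMap.polar Q x y = 0) → x = 0)
    (hiso : ∃ x, x ≠ 0 ∧ Q x = 0) {E : Set K} (h0 : 0 ∉ E) (hne : E.Nonempty)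
    (hne' : ({0}ᶜ \ E).Nonempty)
    (hE : ∀ s, kloostermanSum ψ E s = -E.ncard ∨
      kloostermanSum ψ E s = Fintype.card K - E.ncard) :
    ∃ (κ : AddChar V ℂ → Fin 4) (c : Fin 4 → ℂ) (N : ℂ),
      IsAmorphicPartition (d := 3)
        ![{0}, levelSet Q E, levelSet Q ({0}ᶜ \ E), levelSet Q {0} \ {0}] κ c N := by
  classical
  have hq : (Fintype.card K : ℂ) ≠ 0 := by simp
  obtain ⟨g, rfl⟩ : ∃ g, G = Fintype.card K * g := ⟨G / Fintype.card K, by field_simp⟩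
  let φ := Equiv.ofBijective _ (polarChar_bijective hψ hpol)
  have hsurj := Q.surjective_of_isotropic hpol hiso
  have hQ0 : Q 0 = 0 := Q.map_zero
  -- With `G = q * g`, the level set over `X` has coefficient `g` times the Kloosterman sum of `X`.
  -- The base value of that sum is `-|X|` for each of the three sets, where `|{0}ᶜ \ E| = q - 1 -
  -- |E|`, and the increment is `q`. The final `- 1` in `-g - 1` accounts for removing the zero
  -- vector.
  refine ⟨fun χ => if Q (φ.symm χ) = 0 then 3 else
    if kloostermanSum ψ E (Q (φ.symm χ)) = -E.ncard then 2 else 1,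
    ![1, -E.ncard * g, (E.ncard + 1 - Fintype.card K) * g, -g - 1], Fintype.card K * g,
    ⟨rfl, ?_, ?_, ?_, ?_⟩⟩
  · obtain ⟨a, ha⟩ := hne
    obtain ⟨a', ha'⟩ := hne'
    obtain ⟨x, rfl⟩ := hsurj a
    obtain ⟨x', rfl⟩ := hsurj a'
    obtain ⟨y, hy, hQy⟩ := hiso
    intro i
    fin_cases i
    · exact ⟨0, rfl⟩
    · exact ⟨x, ha⟩
    · exact ⟨x', ha'⟩
    · exact ⟨y, hQy, hy⟩
  · intro x
    by_cases hx : x = 0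
    · refine ⟨0, hx, fun j hj => ?_⟩
      have hQx : Q x = 0 := by rw [hx, hQ0]
      fin_cases j
      · rfl
      · exact absurd (hQx ▸ hj : (0 : K) ∈ E) h0
      · exact absurd hQx (hj : Q x ≠ 0 ∧ Q x ∉ E).1
      · exact absurd hx (hj : Q x = 0 ∧ x ≠ 0).2
    by_cases hx0 : Q x = 0
    · refine ⟨3, ⟨hx0, hx⟩, fun j hj => ?_⟩
      fin_cases j
      · exact absurd hj hx
      · exact absurd (hx0 ▸ hj : (0 : K) ∈ E) h0
      · exact absurd hx0 (hj : Q x ≠ 0 ∧ Q x ∉ E).1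
      · rfl
    by_cases hxE : Q x ∈ E
    · refine ⟨1, hxE, fun j hj => ?_⟩
      fin_cases j
      · exact absurd hj hx
      · rfl
      · exact absurd hxE (hj : Q x ≠ 0 ∧ Q x ∉ E).2
      · exact absurd (hj : Q x = 0 ∧ x ≠ 0).1 hx0
    · refine ⟨2, ⟨hx0, hxE⟩, fun j hj => ?_⟩
      fin_cases j
      · exact absurd hj hx
      · exact absurd hj hxE
      · rfl
      · exact absurd (hj : Q x = 0 ∧ x ≠ 0).1 hx0
  · intro i x hx
    fin_cases i
    · exact neg_eq_zero.2 hx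
    · exact neg_mem_levelSet Q _ x hx
    · exact neg_mem_levelSet Q _ x hx
    · exact ⟨neg_mem_levelSet Q _ x hx.1, fun h => hx.2 (neg_eq_zero.1 h)⟩
  · intro χ hχ
    obtain ⟨b, rfl⟩ := φ.surjective χ
    rw [φ.symm_apply_apply]
    have hφ : φ b = polarChar ψ Q b := rfl
    rw [hφ] at hχ ⊢
    have hlev : ∀ X, charSum (levelSet Q X) (polarChar ψ Q b) = g * kloostermanSum ψ X (Q b) := by
      intro X
      have h := card_mul_charSum_levelSet hψ Q hG X b
      rw [AddChar.sum_eq_zero_iff_ne_zero.2 hχ, mul_zero, zero_add, mul_assoc] at h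
      exact mul_left_cancel₀ hq h
    have hzero : charSum ({0} : Set V) (polarChar ψ Q b) = 1 := by
      simp [charSum, Set.indicator_apply]
    have hdiff : charSum (levelSet Q {0} \ {0}) (polarChar ψ Q b) =
        charSum (levelSet Q {0}) (polarChar ψ Q b) - 1 := by
      rw [← hzero, charSum, charSum, charSum, ← Finset.sum_sub_distrib]
      refine Finset.sum_congr rfl fun x _ => ?_
      by_cases hx : x = 0
      · simp [hx, levelSet]
      · simp [Set.indicator_apply, hx]
    have htot : kloostermanSum ψ E (Q b) + kloostermanSum ψ ({0}ᶜ \ E) (Q b) +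
        kloostermanSum ψ {0} (Q b) = 0 := by
      rw [← kloostermanSum_union ψ Set.disjoint_sdiff_right,
        ← kloostermanSum_union, ← kloostermanSum_univ hψ (Q b)]
      · congr 1
        ext y
        by_cases hy : y = 0 <;> simp [hy]
      · rw [Set.disjoint_singleton_right]
        simp [h0]
    have hcompl := eq_sub_of_add_eq' (eq_neg_of_add_eq_zero_left htot)
    have hs := kloostermanSum_singleton_zero hψ (Q b)
    have hqE : (Fintype.card K : ℂ) - E.ncard ≠ -E.ncard := by
      intro h
      apply hq
      linear_combination h
    -- This leaves, for each value `k` of `κ`, only the three nontrivial coefficients to compare.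
    have hparts : ∀ k : Fin 4, k ≠ 0 →
        g * kloostermanSum ψ E (Q b) =
          -E.ncard * g + (if k = 1 then Fintype.card K * g else 0) →
        g * kloostermanSum ψ ({0}ᶜ \ E) (Q b) =
          (E.ncard + 1 - Fintype.card K) * g + (if k = 2 then Fintype.card K * g else 0) →
        g * kloostermanSum ψ {0} (Q b) - 1 =
          -g - 1 + (if k = 3 then Fintype.card K * g else 0) →
        ∀ i, charSum ((![{0}, levelSet Q E, levelSet Q ({0}ᶜ \ E), levelSet Q {0} \ {0}] :
          Fin 4 → Set V) i) (polarChar ψ Q b) =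
          (![1, -E.ncard * g, (E.ncard + 1 - Fintype.card K) * g, -g - 1] : Fin 4 → ℂ) i +
            if k = i then Fintype.card K * g else 0 := by
      intro k hk h1 h2 h3 i
      rw [← hlev] at h1 h2 h3
      rw [← hdiff] at h3
      fin_cases i
      · exact (by rw [hzero, if_neg hk, add_zero] : charSum ({0} : Set V) (polarChar ψ Q b) =
          1 + if k = 0 then Fintype.card K * g else 0)
      · exact h1
      · exact h2
      · exact h3
    by_cases hb : Q b = 0
    · have hE0 := kloostermanSum_zero hψ h0
      rw [if_pos hb] at hs ⊢
      rw [hs, hb, hE0] at hcompl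
      refine hparts 3 (by decide) ?_ ?_ ?_
      · rw [hb, hE0, if_neg (by decide)]
        ring
      · rw [hb, hcompl, if_neg (by decide)]
        ring
      · rw [hs, if_pos rfl]
        ring
    · rw [if_neg hb] at hs ⊢
      rw [hs] at hcompl
      rcases hE (Q b) with hv | hv <;> rw [hv] at hcompl
      · rw [if_pos hv]
        refine hparts 2 (by decide) ?_ ?_ ?_
        · rw [hv, if_neg (by decide)]
          ring
        · rw [hcompl, if_pos rfl]
          ring
        · rw [hs, if_neg (by decide)]
          ring
      · rw [if_neg (hv.trans_ne hqE)]
        refine hparts 1 (by decide) ?_ ?_ ?_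
        · rw [hv, if_pos rfl]
          ring
        · rw [hcompl, if_neg (by decide)]
          ring
        · rw [hs, if_neg (by decide)]
          ring

theorem mainTheorem12 {K L : Type*} [Field K] [Fintype K] [Field L] [Fintype L] [Algebra K L]
    (hKL : Module.finrank K L = 2)
    (e : ℕ) (he : 1 < e) (hdvd : e ∣ Fintype.card K - 1)
    (I : Set ℕ) (hI : ∀ i ∈ I, i < e)
    (γ : Lˣ) (hγ : ∀ u : Lˣ, u ∈ Subgroup.zpowers γ)
    (ω : Kˣ) (hω : ω = Units.map (Algebra.norm K) γ)
    (E : Set K) (hE : E = ⋃ i ∈ I, cyclotomicClass ω e i)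
    (hsrg : IsNegativeLatinSquareType
      (SimpleGraph.addCayley (⋃ i ∈ I, cyclotomicClass γ e i)))
    (m : ℕ) (Q : QuadraticForm K (Fin (2 * m) → K)) (hQ : Q.radical = ⊥)
    (hiso : ∃ x, x ≠ 0 ∧ Q x = 0) :
    IsStronglyRegular (SimpleGraph.addCayley (levelSet Q E)) ∧
    IsStronglyRegular (SimpleGraph.addCayley (levelSet Q ({0}ᶜ \ E))) ∧
    IsStronglyRegular (SimpleGraph.addCayley (levelSet Q {0} \ {0})) ∧
    IsAmorphicAssociationScheme (graphRelations
      ![SimpleGraph.addCayley (levelSet Q E),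
        SimpleGraph.addCayley (levelSet Q ({0}ᶜ \ E)),
        SimpleGraph.addCayley (levelSet Q {0} \ {0})]) := by
  have hunion : (⋃ i ∈ I, cyclotomicClass γ e i) = levelSet (normForm hKL) E := by
    ext x
    simp only [hE, levelSet, Set.mem_iUnion, Set.mem_ofPred_eq, normForm_apply, hω,
      mem_cyclotomicClass_iff_norm_mem hdvd hγ]
  rw [hunion] at hsrg
  have h0 : (0 : K) ∉ E := by
    simp [hE, zero_notMem_cyclotomicClass]
  have hψ := AddChar.FiniteField.primitiveChar_to_Complex_isPrimitive K
  have hkl := kloostermanSum_eq_or_eq hKL h0 hsrg hψ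
  obtain ⟨_, _, _, -, hbot, htop, -⟩ := hsrg
  have hne : E.Nonempty := by
    rw [Set.nonempty_iff_ne_empty]
    intro hempty
    apply hbot
    simp [hempty, levelSet]
  have hne' : ({0}ᶜ \ E).Nonempty := by
    rw [Set.nonempty_iff_ne_empty]
    intro hempty
    apply htop
    ext x y
    rw [addCayley_adj_iff_sub_mem (zero_notMem_levelSet _ h0) (neg_mem_levelSet _ _),
      SimpleGraph.top_adj]
    constructor
    · rintro hxy rfl
      exact zero_notMem_levelSet _ h0 (by simpa using hxy)
    · intro hxy
      -- If `E` were all of `K \ {0}`, its level set would be `L \ {0}`, as the norm vanishes only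
      -- at `0`, and the given graph would be complete.
      refine Set.sdiff_eq_empty.1 hempty ?_
      simpa [normForm_apply, Algebra.norm_eq_zero_iff, sub_eq_zero] using hxy.symm
  have heven : Even (Module.finrank K (Fin (2 * m) → K)) := by simp
  obtain ⟨κ, c, N, h⟩ := exists_isAmorphicPartition hψ Q
    (fun t ht => sum_addChar_mul_quadraticForm Q hQ heven hψ ht)
    (Q.polar_left_eq_zero_iff_of_even_finrank hQ heven) hiso h0 hne hne' hkl
  have hrel : graphRelations
      ![SimpleGraph.addCayley (levelSet Q E), SimpleGraph.addCayley (levelSet Q ({0}ᶜ \ E)),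
        SimpleGraph.addCayley (levelSet Q {0} \ {0})] =
      fun i x y => y - x ∈ (![{0}, levelSet Q E, levelSet Q ({0}ᶜ \ E), levelSet Q {0} \ {0}] :
        Fin 4 → Set (Fin (2 * m) → K)) i := by
    have hadj : ∀ i : Fin 3, _ := fun i =>
      addCayley_adj_iff_sub_mem (h.zero_notMem (Fin.succ_ne_zero i)) (h.neg_mem i.succ)
    funext i x y
    refine propext ?_
    fin_cases i
    · exact (by rw [sub_eq_zero, eq_comm] : x = y ↔ y - x = 0)
    · exact hadj 0 x y
    · exact hadj 1 x y
    · exact hadj 2 x y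
  refine ⟨h.isStronglyRegular (i := 1) (j := 2) (by decide) (by decide) (by decide),
    h.isStronglyRegular (i := 2) (j := 1) (by decide) (by decide) (by decide),
    h.isStronglyRegular (i := 3) (j := 1) (by decide) (by decide) (by decide), ?_⟩
  rw [hrel]
  exact h.isAmorphicAssociationScheme
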